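/- Lemma. For every integer $k\ge 1$ there is an $n_0=n_0(k)$ such that for all integers $n\ge n_0$ the following holds. Let $G$ be a (finite, simple) graph on $n$ vertices that does not contain the cycle $C_{2k+1}$ on $2k+1$ vertices as a (not necessarily induced) subgraph. Let $e(G)$ and $t(G)$ denote the numbers of edges and of triangles of $G$. Then $$e(G)+t(G)\le\left\lfloor \frac{n^2}{4}\right\rfloor,$$ and equality holds if and only if $G$ is isomorphic to the balanced complete bipartite graph $T_2(n)$ on $n$ vertices (the two-part Turán graph, with parts of sizes $\lfloor n/2\rfloor$ and $\lceil n/2\rceil$). -/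

import Mathlib

/-!
Write `e` and `t` for the numbers of edges and triangles of a graph `G` on `n` vertices without
`C_{2k+1}`. For `k = 1` there are no triangles and the claim is Turán's theorem, so let `k ≥ 2`.

The engine is the notion of a linked set (`IsLinked`): a large set any two of whose vertices have
many common neighbours. Two vertices of a linked set are joined by paths of every small even length
that avoid any few given vertices (`IsLinked.exists_isPath`). Hence an edge whose two ends have
distinct neighbours in a linked set lies on a `C_{2k+1}` (`IsLinked.cycleGraph_isContained`).

This has two consequences. First, the edges lying in triangles contain no large complete bipartite
graph, so there are `o(n ^ 2)` of them (`card_edgeFinset_triangleEdges_le`). Since a neighbourhood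
contains no path on `2k` vertices, the number of triangles at a vertex is linear in its degree
(`triangleDegree_le`), and so also `t = o(n ^ 2)`. If `e + t ≥ ⌊n ^ 2 / 4⌋`, the graph without its
triangle edges is therefore triangle-free with almost `n ^ 2 / 4` edges, and taking the
neighbourhood of a vertex of maximum degree shows that it is almost complete between two parts
(`exists_card_mul_card_compl_le`). Second, the typical vertices of each part form a linked set. If
moreover every vertex lies in at least `⌊n / 2⌋` edges and triangles together, then every degree is
linear in `n`, every vertex has neighbours in one of the two linked sets, and vertices attached to
the same linked set are not adjacent; so there is no triangle at all
(`cliqueFree_three_of_le_degree_add_triangleDegree`).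

A vertex lying in fewer than `⌊n / 2⌋` edges and triangles is deleted, which increases the excess
`e + t - ⌊n ^ 2 / 4⌋`. The excess of a graph of bounded order is bounded, so for large `n` a
positive excess is impossible and excess zero forces a triangle-free graph
(`card_edgeFinset_add_card_cliqueFinset_lt_or_cliqueFree`). Turán's theorem, with its uniqueness
part, finishes the proof.
-/

namespace SimpleGraph

open Finset

/-! ### Linked sets and odd cycles -/

section Linked

variable {V : Type*} [Fintype V] [DecidableEq V] (G : SimpleGraph V) [DecidableRel G.Adj]

/-- A set `S` of at least `M` vertices is `M`-*linked* if any two of its vertices have at least `M`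
common neighbours in `G`. The common neighbours need not lie in `S`. -/
structure IsLinked (M : ℕ) (S : Finset V) : Prop where
  le_card : M ≤ #S
  le_common : ∀ a ∈ S, ∀ b ∈ S, a ≠ b → M ≤ #(G.neighborFinset a ∩ G.neighborFinset b)

variable {G}

/-- Two vertices of a linked set `S` are joined by a path of length `2 * (j + 1)` avoiding `F`:
every other vertex of the path is chosen in `S`, and the ones between as common neighbours. -/
lemma IsLinked.exists_isPath {M : ℕ} {S : Finset V} (hS : G.IsLinked M S) (j : ℕ) :
    ∀ (F : Finset V) (x y : V), x ∈ S → y ∈ S → x ≠ y → x ∉ F → y ∉ F → #F + 2 * j + 3 ≤ M →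
      ∃ p : G.Walk x y, p.IsPath ∧ p.length = 2 * (j + 1) ∧ ∀ w ∈ p.support, w ∉ F := by
  induction j with
  | zero =>
    intro F x y hx hy hxy hxF hyF hM
    obtain ⟨w, hw, hwF⟩ := exists_mem_notMem_of_card_lt_card
      (show #F < #(G.neighborFinset x ∩ G.neighborFinset y) by
        have := hS.le_common x hx y hy hxy
        omega)
    simp only [mem_inter, mem_neighborFinset] at hw
    refine ⟨.cons hw.1 (.cons hw.2.symm .nil), ?_, rfl, ?_⟩
    · simp [Walk.cons_isPath_iff, hw.1.ne, hw.2.ne', hxy]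
    · simp [hxF, hyF, hwF]
  | succ j ih =>
    intro F x y hx hy hxy hxF hyF hM
    have hc1 : #(insert x (insert y F)) ≤ #F + 2 :=
      (card_insert_le _ _).trans (by have := card_insert_le y F; omega)
    obtain ⟨c, hc, hcF⟩ := exists_mem_notMem_of_card_lt_card
      (show #(insert x (insert y F)) < #S by have := hS.le_card; omega)
    simp only [mem_insert, not_or] at hcF
    obtain ⟨w, hw, hwF⟩ := exists_mem_notMem_of_card_lt_card
      (show #(insert x (insert y F)) < #(G.neighborFinset x ∩ G.neighborFinset c) by
        have := hS.le_common x hx c hc (Ne.symm hcF.1)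
        omega)
    simp only [mem_insert, not_or] at hwF
    simp only [mem_inter, mem_neighborFinset] at hw
    have hc2 : #(insert x (insert w F)) ≤ #F + 2 :=
      (card_insert_le _ _).trans (by have := card_insert_le w F; omega)
    obtain ⟨p, hp, hl, hpF⟩ := ih (insert x (insert w F)) c y hc hy hcF.2.1
      (by simp [hcF.1, hcF.2.2, hw.2.ne]) (by simp [hxy.symm, Ne.symm hwF.2.1, hyF]) (by omega)
    have hx' : x ∉ p.support := fun h ↦ hpF x h (by simp)
    have hw' : w ∉ p.support := fun h ↦ hpF w h (by simp)
    refine ⟨.cons hw.1 (.cons hw.2.symm p), ?_, by simp [hl]; ring, ?_⟩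
    · simp [Walk.cons_isPath_iff, hp, hx', hw', hw.1.ne]
    · simp only [Walk.support_cons, List.mem_cons]
      rintro z (rfl | rfl | hz)
      · exact hxF
      · exact hwF.2.2
      · exact fun h ↦ hpF z hz (by simp [h])

end Linked

/-- A path whose ends are adjacent closes up to a cycle. -/
lemma Walk.IsPath.cycleGraph_isContained {V : Type*} {G : SimpleGraph V} {x y : V} {n : ℕ}
    {p : G.Walk x y} (hp : p.IsPath) (hl : p.length + 1 = n) (h2 : 3 ≤ n) (h : G.Adj y x) :
    (cycleGraph n).IsContained G := by
  refine (cycleGraph_isContained_iff h2).2 ⟨y, .cons h p, ?_, by simpa using hl⟩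
  refine (Walk.cons_isCycle_iff _ _).2 ⟨hp, fun he ↦ ?_⟩
  have := hp.length_eq_one_of_mem_edges (Sym2.eq_swap ▸ he)
  omega

section Linked

variable {V : Type*} [Fintype V] [DecidableEq V] {G : SimpleGraph V} [DecidableRel G.Adj]

/-- Two vertices of a linked set are joined by a path of length `2 * k - 2` avoiding a prescribed
edge `uv`, which closes up to an odd cycle through that edge. -/
lemma IsLinked.cycleGraph_isContained {M k : ℕ} {S : Finset V} (hS : G.IsLinked M S) (hk : 2 ≤ k)
    (hM : 2 * k + 1 ≤ M) {u v x y : V} (huv : G.Adj u v) (hx : x ∈ S) (hy : y ∈ S) (hxy : x ≠ y)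
    (hux : G.Adj u x) (hvy : G.Adj v y) (hxv : x ≠ v) (hyu : y ≠ u) :
    (cycleGraph (2 * k + 1)).IsContained G := by
  obtain ⟨j, rfl⟩ := Nat.exists_eq_add_of_le' hk
  have hF : #({u, v} : Finset V) ≤ 2 := card_le_two
  obtain ⟨p, hp, hl, hpF⟩ := hS.exists_isPath j {u, v} x y hx hy hxy
    (by simp [hux.ne', hxv]) (by simp [hyu, hvy.ne']) (by omega)
  have hu : u ∉ p.support := fun h ↦ hpF u h (by simp)
  have hv : v ∉ p.support := fun h ↦ hpF v h (by simp)
  have hq : (Walk.cons hux (p.concat hvy.symm)).IsPath := by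
    simp [Walk.cons_isPath_iff, Walk.concat_isPath_iff, Walk.support_concat, hp, hu, hv, huv.ne]
  exact hq.cycleGraph_isContained (by simp [hl]; ring) (by omega) huv.symm

/-- In a graph without `C_{2k+1}`, if every vertex has several neighbours in a linked set, then
there are no triangles: two of the three vertices of a triangle have three neighbours in the same
linked set. -/
lemma cliqueFree_three_of_isLinked {M k : ℕ} {S T : Finset V} (hS : G.IsLinked M S)
    (hT : G.IsLinked M T) (hk : 2 ≤ k) (hM : 2 * k + 1 ≤ M)
    (hG : (cycleGraph (2 * k + 1)).Free G)
    (h : ∀ v, 3 ≤ #(G.neighborFinset v ∩ S) ∨ 3 ≤ #(G.neighborFinset v ∩ T)) :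
    G.CliqueFree 3 := by
  have key : ∀ R, G.IsLinked M R → ∀ u v, G.Adj u v → 3 ≤ #(G.neighborFinset u ∩ R) →
      3 ≤ #(G.neighborFinset v ∩ R) → False := by
    intro R hR u v huv hu hv
    obtain ⟨x, hx, hx'⟩ := exists_mem_notMem_of_card_lt_card
      (show #({v} : Finset V) < #(G.neighborFinset u ∩ R) by simp; omega)
    obtain ⟨y, hy, hy'⟩ := exists_mem_notMem_of_card_lt_card
      (show #({u, x} : Finset V) < #(G.neighborFinset v ∩ R) from card_le_two.trans_lt (by omega))
    simp only [mem_inter, mem_neighborFinset, mem_singleton, mem_insert, not_or] at hx hx' hy hy'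
    exact hG (hR.cycleGraph_isContained hk hM huv hx.2 hy.2 (Ne.symm hy'.2) hx.1 hy.1 hx' hy'.1)
  intro s hs
  obtain ⟨a, b, c, hab, hac, hbc, -⟩ := is3Clique_iff.1 hs
  rcases h a with ha | ha <;> rcases h b with hb | hb <;> rcases h c with hc | hc
  all_goals first
    | exact key S hS a b hab ‹_› ‹_› | exact key T hT a b hab ‹_› ‹_›
    | exact key S hS a c hac ‹_› ‹_› | exact key T hT a c hac ‹_› ‹_›
    | exact key S hS b c hbc ‹_› ‹_› | exact key T hT b c hbc ‹_› ‹_›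

end Linked

/-! ### Sets of vertices containing no long path -/

section Paths

variable {V : Type*} [Fintype V] [DecidableEq V] {G : SimpleGraph V} [DecidableRel G.Adj]

/-- A path is grown greedily inside a set of vertices of large degree within that set. -/
lemma exists_isPath_of_le_card_neighborFinset_inter {S : Finset V} (hne : S.Nonempty) {d : ℕ}
    (h : ∀ v ∈ S, d ≤ #(G.neighborFinset v ∩ S)) (j : ℕ) (hj : j ≤ d) :
    ∃ (x y : V) (p : G.Walk x y), p.IsPath ∧ p.length = j ∧ ∀ w ∈ p.support, w ∈ S := by
  induction j with
  | zero =>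
    obtain ⟨x, hx⟩ := hne
    exact ⟨x, x, .nil, by simp, rfl, by simpa⟩
  | succ j ih =>
    obtain ⟨x, y, p, hp, hl, hpS⟩ := ih (by omega)
    have hc : #(p.support.toFinset.erase x) < #(G.neighborFinset x ∩ S) := by
      have h1 := h x (hpS x p.start_mem_support)
      have h2 := List.toFinset_card_le p.support
      rw [card_erase_of_mem (by simp), Walk.length_support] at *
      omega
    obtain ⟨w, hw, hw'⟩ := exists_mem_notMem_of_card_lt_card hc
    simp only [mem_inter, mem_neighborFinset, mem_erase, List.mem_toFinset, not_and] at hw hw'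
    refine ⟨w, y, .cons hw.1.symm p, ?_, by simp [hl], ?_⟩
    · exact (Walk.cons_isPath_iff _ _).2 ⟨hp, hw' hw.1.ne'⟩
    · simpa [hw.2] using hpS

/-- A weak form of the Erdős–Gallai theorem: if `G` has no path of length `d` inside `S`, then it
has at most `d * #S` edges inside `S`. -/
lemma sum_card_neighborFinset_inter_le {d : ℕ} (n : ℕ) : ∀ S : Finset V, #S = n →
    (∀ (x y : V) (p : G.Walk x y), p.IsPath → p.length = d → ¬ ∀ w ∈ p.support, w ∈ S) →
    ∑ w ∈ S, #(G.neighborFinset w ∩ S) ≤ 2 * d * #S := by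
  induction n with
  | zero =>
    intro S hS _
    simp [card_eq_zero.1 hS]
  | succ n ih =>
    intro S hS hp
    have hne : S.Nonempty := card_pos.1 (by omega)
    obtain ⟨v, hv, hvd⟩ : ∃ v ∈ S, #(G.neighborFinset v ∩ S) < d := by
      by_contra! hcon
      obtain ⟨x, y, p, h1, h2, h3⟩ :=
        exists_isPath_of_le_card_neighborFinset_inter hne hcon d le_rfl
      exact hp x y p h1 h2 h3
    have hcard : #(S.erase v) = n := by rw [card_erase_of_mem hv]; omega
    have ih' := ih (S.erase v) hcard
      fun x y p h1 h2 h3 ↦ hp x y p h1 h2 fun w hw ↦ mem_of_mem_erase (h3 w hw)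
    have hsplit : ∑ w ∈ S.erase v, #(G.neighborFinset w ∩ S)
        = ∑ w ∈ S.erase v, #(G.neighborFinset w ∩ S.erase v) + #(G.neighborFinset v ∩ S) := by
      have h1 : #(G.neighborFinset v ∩ S) = ∑ w ∈ S.erase v, if G.Adj w v then 1 else 0 := by
        rw [← card_filter]
        congr 1
        ext w
        simp only [mem_inter, mem_neighborFinset, mem_filter, mem_erase]
        exact ⟨fun h ↦ ⟨⟨h.1.ne', h.2⟩, h.1.symm⟩, fun h ↦ ⟨h.2.symm, h.1.2⟩⟩
      rw [h1, ← sum_add_distrib]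
      refine sum_congr rfl fun w _ ↦ ?_
      rw [inter_erase]
      split_ifs with hw
      · have hm : v ∈ G.neighborFinset w ∩ S := by simp [hw, hv]
        rw [card_erase_of_mem hm]
        have := card_pos.2 ⟨v, hm⟩
        omega
      · rw [erase_eq_of_notMem (by simp [hw]), add_zero]
    rw [← add_sum_erase S _ hv, hsplit, hS]
    rw [hcard] at ih'
    nlinarith

end Paths

/-! ### Triangles and the edges they use -/

section Triangles

/-- The subgraph of `G` formed by the edges that lie in a triangle of `G`. -/
def triangleEdges {V : Type*} (G : SimpleGraph V) : SimpleGraph V where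
  Adj x y := G.Adj x y ∧ ∃ z, G.Adj x z ∧ G.Adj y z
  symm := ⟨fun _ _ h ↦ ⟨h.1.symm, h.2.imp fun _ h ↦ h.symm⟩⟩
  loopless := ⟨fun _ h ↦ h.1.ne rfl⟩

lemma triangleEdges_le {V : Type*} {G : SimpleGraph V} : G.triangleEdges ≤ G := fun _ _ h ↦ h.1

lemma cliqueFree_three_sdiff_triangleEdges {V : Type*} [DecidableEq V] {G : SimpleGraph V} :
    (G \ G.triangleEdges).CliqueFree 3 := by
  intro s hs
  obtain ⟨a, b, c, hab, hac, hbc, -⟩ := is3Clique_iff.1 hs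
  simp only [sdiff_adj] at hab hac hbc
  exact hab.2 ⟨hab.1, c, hac.1, hbc.1⟩

variable {V : Type*} [Fintype V] [DecidableEq V] (G : SimpleGraph V) [DecidableRel G.Adj]

instance : DecidableRel G.triangleEdges.Adj :=
  fun x y ↦ inferInstanceAs (Decidable (G.Adj x y ∧ ∃ z, G.Adj x z ∧ G.Adj y z))

/-- The number of triangles of `G` through the vertex `v`. -/
def triangleDegree (v : V) : ℕ := #{s ∈ G.cliqueFinset 3 | v ∈ s}

lemma sum_triangleDegree : ∑ v, G.triangleDegree v = 3 * #(G.cliqueFinset 3) := by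
  have h := sum_card_bipartiteAbove_eq_sum_card_bipartiteBelow (s := (univ : Finset V))
    (t := G.cliqueFinset 3) (fun v s ↦ v ∈ s)
  have h2 : ∀ s ∈ G.cliqueFinset 3,
      #(bipartiteBelow (fun v s ↦ v ∈ s) (univ : Finset V) s) = 3 := by
    intro s hs
    rw [← ((mem_cliqueFinset_iff).1 hs).card_eq]
    congr 1
    ext
    simp [bipartiteBelow]
  rw [sum_congr rfl h2, sum_const, smul_eq_mul, mul_comm] at h
  exact h

variable {G}

/-- Each triangle `vwz` is counted at both `w` and `z`. -/
lemma two_mul_triangleDegree_le (v : V) :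
    2 * G.triangleDegree v ≤ ∑ w ∈ G.triangleEdges.neighborFinset v,
      #(G.neighborFinset w ∩ G.triangleEdges.neighborFinset v) := by
  set S := G.triangleEdges.neighborFinset v with hS
  set T := {s ∈ G.cliqueFinset 3 | v ∈ s} with hT
  have h := sum_card_bipartiteAbove_eq_sum_card_bipartiteBelow (s := S) (t := T) (fun w s ↦ w ∈ s)
  have h2 : ∀ s ∈ T, 2 ≤ #(bipartiteBelow (fun w s ↦ w ∈ s) S s) := by
    intro s hs
    simp only [hT, mem_filter, mem_cliqueFinset_iff] at hs
    have h3 : #(s.erase v) = 2 := by rw [card_erase_of_mem hs.2, hs.1.card_eq]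
    rw [← h3]
    refine card_le_card fun w hw ↦ ?_
    simp only [mem_erase] at hw
    obtain ⟨z, hz⟩ : ∃ z ∈ s, z ≠ v ∧ z ≠ w := by
      obtain ⟨z, hz, hz'⟩ := exists_mem_notMem_of_card_lt_card (s := {v, w}) (t := s)
        (card_le_two.trans_lt (by rw [hs.1.card_eq]; omega))
      exact ⟨z, hz, by simpa using hz'⟩
    have hc := hs.1.isClique
    simp only [bipartiteBelow, hS, mem_filter, mem_neighborFinset]
    exact ⟨⟨hc hs.2 hw.2 (Ne.symm hw.1), z, hc hs.2 hz.1 (Ne.symm hz.2.1),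
      hc hw.2 hz.1 (Ne.symm hz.2.2)⟩, hw.2⟩
  have h3 : ∀ w ∈ S, #(bipartiteAbove (fun w s ↦ w ∈ s) T w) ≤ #(G.neighborFinset w ∩ S) := by
    intro w hw
    simp only [hS, mem_neighborFinset] at hw
    refine (card_le_card (t := (G.neighborFinset w ∩ S).image fun z ↦ {v, w, z}) ?_).trans
      card_image_le
    intro s hs
    simp only [bipartiteAbove, hT, mem_filter, mem_cliqueFinset_iff] at hs
    obtain ⟨⟨hs, hv⟩, hws⟩ := hs
    obtain ⟨z, hz, hz'⟩ := exists_mem_notMem_of_card_lt_card (s := {v, w}) (t := s)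
        (card_le_two.trans_lt (by rw [hs.card_eq]; omega))
    simp only [mem_insert, mem_singleton, not_or] at hz'
    have hc := hs.isClique
    have hvz := hc hv hz (Ne.symm hz'.1)
    have hwz := hc hws hz (Ne.symm hz'.2)
    refine mem_image.2 ⟨z, ?_, ?_⟩
    · simp only [hS, mem_inter, mem_neighborFinset]
      exact ⟨hwz, hvz, w, hw.1, hwz.symm⟩
    · refine eq_of_subset_of_card_le ?_ ?_
      · simp [insert_subset_iff, hv, hws, hz]
      · rw [hs.card_eq, card_eq_three.2 ⟨v, w, z, hw.1.ne, hvz.ne, hwz.ne, rfl⟩]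
  calc 2 * G.triangleDegree v = ∑ s ∈ T, 2 := by rw [sum_const, smul_eq_mul, mul_comm]; rfl
    _ ≤ _ := sum_le_sum h2
    _ = _ := h.symm
    _ ≤ _ := sum_le_sum h3

/-- A path on `2 * k` vertices in the neighbourhood of `v` closes up to a `C_{2k+1}` through `v`, so
the neighbourhoods span few edges. -/
lemma triangleDegree_le {k : ℕ} (hk : 1 ≤ k) (hG : (cycleGraph (2 * k + 1)).Free G) (v : V) :
    G.triangleDegree v ≤ 2 * k * G.triangleEdges.degree v := by
  have h := sum_card_neighborFinset_inter_le (G := G) (d := 2 * k - 1) _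
    (G.triangleEdges.neighborFinset v) rfl fun x y p hp hl hpS ↦ by
      have hadj : ∀ w ∈ p.support, G.Adj v w := fun w hw ↦
        triangleEdges_le ((mem_neighborFinset _ _ _).1 (hpS w hw))
      have hq : (Walk.cons (hadj x p.start_mem_support) p).IsPath :=
        (Walk.cons_isPath_iff _ _).2 ⟨hp, fun h ↦ (hadj v h).ne rfl⟩
      exact hG (hq.cycleGraph_isContained (by simp [hl]; omega) (by omega)
        (hadj y p.end_mem_support).symm)
  have h2 := two_mul_triangleDegree_le (G := G) v
  rw [card_neighborFinset_eq_degree] at h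
  have h3 : (2 * (2 * k - 1)) * G.triangleEdges.degree v ≤ 2 * (2 * k) * G.triangleEdges.degree v :=
    Nat.mul_le_mul_right _ (by omega)
  nlinarith

lemma three_mul_card_cliqueFinset_three_le {k : ℕ} (hk : 1 ≤ k)
    (hG : (cycleGraph (2 * k + 1)).Free G) :
    3 * #(G.cliqueFinset 3) ≤ 4 * k * #G.triangleEdges.edgeFinset := by
  calc _ = ∑ v, G.triangleDegree v := (sum_triangleDegree G).symm
    _ ≤ ∑ v, 2 * k * G.triangleEdges.degree v := sum_le_sum fun v _ ↦ triangleDegree_le hk hG v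
    _ = 2 * k * (2 * #G.triangleEdges.edgeFinset) := by
      rw [← mul_sum, sum_degrees_eq_twice_card_edges]
    _ = _ := by ring

end Triangles

/-! ### Deleting a vertex -/

section Deletion

variable {V : Type*} [Fintype V] [DecidableEq V] {G : SimpleGraph V} [DecidableRel G.Adj]

lemma card_cliqueFinset_three_le_induce (v : V) :
    #(G.cliqueFinset 3) ≤ #((G.induce {v}ᶜ).cliqueFinset 3) + G.triangleDegree v := by
  rw [← card_filter_add_card_filter_not (s := G.cliqueFinset 3) (p := fun s ↦ v ∈ s), add_comm]
  refine Nat.add_le_add_right ?_ _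
  refine (card_le_card (t := ((G.induce {v}ᶜ).cliqueFinset 3).image
    fun s ↦ s.map (.subtype _)) ?_).trans card_image_le
  intro s hs
  simp only [mem_filter, mem_cliqueFinset_iff] at hs
  have hm : (s.subtype (· ∈ ({v}ᶜ : Set V))).map (.subtype _) = s :=
    subtype_map_of_mem fun x hx ↦ by
      rintro rfl
      exact hs.2 hx
  refine mem_image.2 ⟨s.subtype (· ∈ ({v}ᶜ : Set V)), ?_, hm⟩
  rw [mem_cliqueFinset_iff, isNClique_induce_iff, hm]
  exact hs.1

lemma card_edgeFinset_induce_add_degree (v : V) :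
    #(G.induce {v}ᶜ).edgeFinset + G.degree v = #G.edgeFinset := by
  rw [card_edgeFinset_induce_compl_singleton, card_edgeFinset_deleteIncidenceSet]
  exact Nat.sub_add_cancel (G.degree_le_card_edgeFinset v)

end Deletion

/-! ### Triangle edges are sparse -/

section KovariSosTuran

/-- A qualitative form of the Kővári–Sós–Turán theorem: dense graphs contain large complete
bipartite graphs. -/
lemma exists_forall_adj_of_lt_card_edgeFinset (m M : ℕ) {ε : ℝ} (hε : 0 < ε) :
    ∃ n₀ : ℕ, ∀ (V : Type*) [Fintype V] [DecidableEq V] (F : SimpleGraph V) [DecidableRel F.Adj],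
      n₀ ≤ Fintype.card V → ε * (Fintype.card V : ℝ) ^ 2 < #F.edgeFinset →
        ∃ S T : Finset V, #S = m ∧ M ≤ #T ∧ ∀ a ∈ S, ∀ b ∈ T, F.Adj a b := by
  obtain ⟨n₁, hn₁⟩ := exists_nat_gt (2 * m / ε)
  obtain ⟨n₂, hn₂⟩ := exists_nat_gt (M / (ε * (ε / 2) ^ m))
  refine ⟨max n₁ n₂ + 1, fun V _ _ F _ hn he ↦ ?_⟩
  by_contra! hcon
  set n := Fintype.card V with hndef
  have h1 : 2 * m / ε < (n : ℝ) := hn₁.trans_le (by exact_mod_cast (by omega : n₁ ≤ n))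
  have h2 : M / (ε * (ε / 2) ^ m) < (n : ℝ) := hn₂.trans_le (by exact_mod_cast (by omega : n₂ ≤ n))
  have hn0 : (0 : ℝ) < n := by exact_mod_cast (by omega : 0 < n)
  rw [div_lt_iff₀ hε] at h1
  rw [div_lt_iff₀ (by positivity)] at h2
  -- count the pairs of an `m`-set and a common neighbour of all its elements
  have hcount := sum_card_bipartiteAbove_eq_sum_card_bipartiteBelow (s := (univ : Finset V))
    (t := powersetCard m univ) (fun b S ↦ S ⊆ F.neighborFinset b)
  have hleft : ∀ b, #(bipartiteAbove (fun b S ↦ S ⊆ F.neighborFinset b) (powersetCard m univ) b)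
      = (F.degree b).choose m := by
    intro b
    rw [← card_neighborFinset_eq_degree, ← card_powersetCard]
    congr 1
    ext S
    simp only [bipartiteAbove, mem_filter, mem_powersetCard, subset_univ, true_and]
    tauto
  have hright : ∀ S ∈ powersetCard m (univ : Finset V),
      #(bipartiteBelow (fun b S ↦ S ⊆ F.neighborFinset b) univ S) ≤ M := by
    intro S hS
    by_contra! hlt
    obtain ⟨a, ha, b, hb, hab⟩ := hcon S _ (mem_powersetCard.1 hS).2 hlt.le
    simp only [bipartiteBelow, mem_filter, mem_univ, true_and] at hb
    exact hab ((mem_neighborFinset _ _ _).1 (hb ha)).symm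
  have hupper : (∑ b, (F.degree b).choose m : ℕ) ≤ M * n.choose m := by
    rw [← sum_congr rfl fun b _ ↦ hleft b, hcount]
    refine (sum_le_sum hright).trans ?_
    rw [sum_const, card_powersetCard, card_univ, smul_eq_mul, mul_comm]
  -- the vertices of degree below `ε * n` account for at most half of the degree sum
  have hBcard : ε * n ≤ #{b : V | ε * n ≤ F.degree b} := by
    have hs : ∑ b, (F.degree b : ℝ) = 2 * #F.edgeFinset := by
      exact_mod_cast F.sum_degrees_eq_twice_card_edges
    have hle : ∑ b, (F.degree b : ℝ) ≤ ∑ b : V, ((if ε * n ≤ F.degree b then (n : ℝ) else 0)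
        + ε * n) := by
      refine sum_le_sum fun b _ ↦ ?_
      split_ifs with hb
      · have : (F.degree b : ℝ) ≤ n := by exact_mod_cast (F.degree_lt_card_verts b).le
        have : 0 < ε * n := by positivity
        linarith
      · linarith
    rw [sum_add_distrib, sum_ite, sum_const_zero, add_zero, sum_const, sum_const, card_univ,
      nsmul_eq_mul, nsmul_eq_mul, ← hndef, hs] at hle
    have : ε * n * n ≤ (#{b : V | ε * n ≤ F.degree b} : ℝ) * n := by nlinarith
    exact le_of_mul_le_mul_right this hn0
  have hlower : ε * n * ((ε / 2 * n) ^ m / m.factorial) ≤ ∑ b, ((F.degree b).choose m : ℝ) := by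
    calc _ ≤ (#{b : V | ε * n ≤ F.degree b} : ℝ) * ((ε / 2 * n) ^ m / m.factorial) := by gcongr
      _ = ∑ b : V with ε * n ≤ F.degree b, ((ε / 2 * n) ^ m / m.factorial : ℝ) := by
        rw [sum_const, nsmul_eq_mul]
      _ ≤ ∑ b : V with ε * n ≤ F.degree b, ((F.degree b).choose m : ℝ) := by
        refine sum_le_sum fun b hb ↦ ?_
        have hb : ε * n ≤ F.degree b := (mem_filter.1 hb).2
        refine le_trans ?_ (Nat.pow_le_choose m (F.degree b))
        have hm : m ≤ F.degree b + 1 := by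
          have : (m : ℝ) ≤ F.degree b + 1 := by linarith
          exact_mod_cast this
        rw [Nat.cast_sub hm]
        push_cast
        gcongr
        linarith
      _ ≤ _ := sum_le_sum_of_subset_of_nonneg (subset_univ _) fun _ _ _ ↦ by positivity
  have hchoose : (M : ℝ) * n.choose m ≤ M * (n ^ m / m.factorial) := by
    gcongr
    exact Nat.choose_le_pow_div m n
  have hupper' : ∑ b, ((F.degree b).choose m : ℝ) ≤ M * n.choose m := by exact_mod_cast hupper
  have hfin := hlower.trans (hupper'.trans hchoose)
  rw [mul_pow] at hfin
  have hpos : (0 : ℝ) < n ^ m / m.factorial := by positivity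
  have : ε * (ε / 2) ^ m * n * (n ^ m / m.factorial) ≤ M * (n ^ m / m.factorial : ℝ) := by
    calc _ = ε * n * ((ε / 2) ^ m * n ^ m / m.factorial) := by ring
      _ ≤ _ := hfin
  have := le_of_mul_le_mul_right this hpos
  linarith

/-- A complete bipartite graph of triangle edges would have a linked side `S`, and a triangle on one
of its edges leads to a `C_{2k+1}`. -/
lemma card_edgeFinset_triangleEdges_le {k : ℕ} (hk : 2 ≤ k) {ε : ℝ} (hε : 0 < ε) :
    ∃ n₀ : ℕ, ∀ (V : Type*) [Fintype V] [DecidableEq V] (G : SimpleGraph V) [DecidableRel G.Adj],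
      n₀ ≤ Fintype.card V → (cycleGraph (2 * k + 1)).Free G →
        (#G.triangleEdges.edgeFinset : ℝ) ≤ ε * (Fintype.card V : ℝ) ^ 2 := by
  obtain ⟨n₀, h⟩ := exists_forall_adj_of_lt_card_edgeFinset (2 * k + 1) (2 * k + 1) hε
  refine ⟨n₀, fun V _ _ G _ hn hG ↦ ?_⟩
  by_contra! hlt
  obtain ⟨S, T, hS, hT, hST⟩ := h V G.triangleEdges hn hlt
  have hL : G.IsLinked (2 * k + 1) S := by
    refine ⟨hS.ge, fun a ha b hb _ ↦ hT.trans (card_le_card fun t ht ↦ ?_)⟩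
    simp only [mem_inter, mem_neighborFinset]
    exact ⟨(hST a ha t ht).1, (hST b hb t ht).1⟩
  obtain ⟨a, ha⟩ : S.Nonempty := card_pos.1 (by omega)
  obtain ⟨b, hb⟩ : T.Nonempty := card_pos.1 (by omega)
  obtain ⟨hab, z, haz, hbz⟩ := hST a ha b hb
  -- the edge `bz` has the neighbour `a` of `z` and a further neighbour `x` of `b` in `S`
  obtain ⟨x, hx, hx'⟩ := exists_mem_notMem_of_card_lt_card (s := {a, z}) (t := S)
    (card_le_two.trans_lt (by omega))
  simp only [mem_insert, mem_singleton, not_or] at hx'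
  exact hG (hL.cycleGraph_isContained hk le_rfl hbz hx ha hx'.1 (hST x hx b hb).1.symm haz.symm
    hx'.2 hab.ne)

end KovariSosTuran

/-! ### Near-complete cuts -/

section Stability

variable {V : Type*} [Fintype V] [DecidableEq V] {G : SimpleGraph V} [DecidableRel G.Adj]

lemma sum_card_neighborFinset_inter_comm (A B : Finset V) :
    ∑ a ∈ A, #(G.neighborFinset a ∩ B) = ∑ b ∈ B, #(G.neighborFinset b ∩ A) := by
  have h := sum_card_bipartiteAbove_eq_sum_card_bipartiteBelow (s := A) (t := B) G.Adj
  convert h using 2 with a _ b _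
  all_goals
    congr 1
    ext
    simp [bipartiteAbove, bipartiteBelow, and_comm, G.adj_comm]

/-- In a triangle-free graph the neighbourhood `A` of a vertex of maximum degree is independent,
and no vertex outside `A` has degree more than `#A`. -/
lemma CliqueFree.exists_two_mul_card_edgeFinset_le (hG : G.CliqueFree 3) :
    ∃ A : Finset V,
      2 * #G.edgeFinset ≤ ∑ a ∈ A, #(G.neighborFinset a ∩ Aᶜ) + #A * #Aᶜ := by
  rcases isEmpty_or_nonempty V with hV | hV
  · exact ⟨∅, by simp [← sum_degrees_eq_twice_card_edges]⟩
  obtain ⟨x, hx⟩ := G.exists_maximal_degree_vertex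
  refine ⟨G.neighborFinset x, ?_⟩
  rw [← sum_degrees_eq_twice_card_edges, ← sum_add_sum_compl (G.neighborFinset x)]
  refine Nat.add_le_add (sum_le_sum fun a ha ↦ ?_) ?_
  · rw [← card_neighborFinset_eq_degree]
    refine card_le_card fun b hb ↦ ?_
    simp only [mem_inter, mem_compl, mem_neighborFinset] at *
    exact ⟨hb, fun hxb ↦ hG {x, a, b} (is3Clique_triple_iff.2 ⟨ha, hxb, hb⟩)⟩
  · rw [card_neighborFinset_eq_degree, ← hx, mul_comm, ← smul_eq_mul, ← sum_const]
    exact sum_le_sum fun b _ ↦ G.degree_le_maxDegree b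

/-- The vertices of `B` that are adjacent to all but at most `γ` vertices of `A`. -/
def nearlyComplete (G : SimpleGraph V) [DecidableRel G.Adj] (A B : Finset V) (γ : ℕ) : Finset V :=
  {b ∈ B | #A ≤ #(G.neighborFinset b ∩ A) + γ}

lemma mul_card_sdiff_nearlyComplete_le {A B : Finset V} {γ : ℕ} {D : ℝ}
    (h : (#A * #B : ℝ) ≤ (∑ b ∈ B, #(G.neighborFinset b ∩ A) : ℕ) + D) :
    (γ * #(B \ G.nearlyComplete A B γ) : ℝ) ≤ D := by
  have h1 : ∑ b ∈ B, (#A : ℝ) - ∑ b ∈ B, (#(G.neighborFinset b ∩ A) : ℝ) ≤ D := by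
    rw [sum_const, nsmul_eq_mul]
    push_cast at h
    linarith
  rw [← sum_sub_distrib] at h1
  refine le_trans ?_ h1
  calc (γ * #(B \ G.nearlyComplete A B γ) : ℝ) = ∑ b ∈ B \ G.nearlyComplete A B γ, (γ : ℝ) := by
        rw [sum_const, nsmul_eq_mul, mul_comm]
    _ ≤ ∑ b ∈ B \ G.nearlyComplete A B γ, ((#A : ℝ) - #(G.neighborFinset b ∩ A)) := by
        refine sum_le_sum fun b hb ↦ ?_
        simp only [nearlyComplete, mem_sdiff, mem_filter, not_and, not_le] at hb
        have : (#(G.neighborFinset b ∩ A) + γ : ℝ) < #A := by exact_mod_cast hb.2 hb.1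
        linarith
    _ ≤ _ := by
        refine sum_le_sum_of_subset_of_nonneg sdiff_subset fun b _ _ ↦ ?_
        have : (#(G.neighborFinset b ∩ A) : ℝ) ≤ #A := by
          exact_mod_cast card_le_card inter_subset_right
        linarith

lemma isLinked_nearlyComplete {A B : Finset V} {γ M : ℕ} (hA : M + 2 * γ ≤ #A)
    (hB : M ≤ #(G.nearlyComplete A B γ)) : G.IsLinked M (G.nearlyComplete A B γ) := by
  refine ⟨hB, fun x hx y hy _ ↦ ?_⟩
  have hx := (mem_filter.1 hx).2
  have hy := (mem_filter.1 hy).2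
  have h1 := card_union_add_card_inter (G.neighborFinset x ∩ A) (G.neighborFinset y ∩ A)
  have h2 : #(G.neighborFinset x ∩ A ∪ G.neighborFinset y ∩ A) ≤ #A :=
    card_le_card (union_subset inter_subset_right inter_subset_right)
  have h3 : #(G.neighborFinset x ∩ A ∩ (G.neighborFinset y ∩ A))
      ≤ #(G.neighborFinset x ∩ G.neighborFinset y) :=
    card_le_card (inter_subset_inter inter_subset_left inter_subset_left)
  omega

end Stability

/-! ### Graphs in which every vertex lies in many edges and triangles -/

section Structure

/-- Deleting the edges in triangles costs only `o(n ^ 2)` edges, and the remaining triangle-free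
graph has almost `n ^ 2 / 4` edges, so it is almost complete between some set and its complement. -/
lemma exists_card_mul_card_compl_le {k : ℕ} (hk : 2 ≤ k) {η : ℝ} (hη : 0 < η) :
    ∃ n₀ : ℕ, ∀ (V : Type*) [Fintype V] [DecidableEq V] (G : SimpleGraph V) [DecidableRel G.Adj],
      n₀ ≤ Fintype.card V → (cycleGraph (2 * k + 1)).Free G →
        Fintype.card V ^ 2 / 4 ≤ #G.edgeFinset + #(G.cliqueFinset 3) →
          ∃ A : Finset V,
            (Fintype.card V : ℝ) ^ 2 / 4 - η * (Fintype.card V : ℝ) ^ 2 ≤ #A * #Aᶜ ∧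
            (#A * #Aᶜ : ℝ) ≤ (∑ a ∈ A, #(G.neighborFinset a ∩ Aᶜ) : ℕ)
              + 2 * η * (Fintype.card V : ℝ) ^ 2 := by
  obtain ⟨ε, hε⟩ : ∃ ε : ℝ, ε = η / (2 * (1 + 2 * k)) := ⟨_, rfl⟩
  have hε0 : 0 < ε := by rw [hε]; positivity
  have hεη : ε * (1 + 2 * k) = η / 2 := by rw [hε]; field_simp
  obtain ⟨n₁, hn₁⟩ := card_edgeFinset_triangleEdges_le hk hε0
  obtain ⟨n₂, hn₂⟩ := exists_nat_gt (2 / η)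
  refine ⟨max n₁ n₂ + 1, fun V _ _ G _ hn hG hedge ↦ ?_⟩
  have hsparse := hn₁ V G (by omega) hG
  obtain ⟨A, hA⟩ :=
    (cliqueFree_three_sdiff_triangleEdges (G := G)).exists_two_mul_card_edgeFinset_le
  have hAc : (#A : ℝ) + #Aᶜ = Fintype.card V := by exact_mod_cast card_add_card_compl A
  generalize Fintype.card V = n at *
  have h2 : 2 / η < (n : ℝ) := hn₂.trans_le (by exact_mod_cast (by omega : n₂ ≤ n))
  rw [div_lt_iff₀ hη] at h2
  have hn1 : (1 : ℝ) ≤ n := by exact_mod_cast (by omega : 1 ≤ n)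
  have hedges : #(G \ G.triangleEdges).edgeFinset + #G.triangleEdges.edgeFinset
      = #G.edgeFinset := by
    rw [edgeFinset_sdiff]
    exact card_sdiff_add_card_eq_card (edgeFinset_mono triangleEdges_le)
  have htri := three_mul_card_cliqueFinset_three_le (by omega : 1 ≤ k) hG
  have hH : (n : ℝ) ^ 2 / 4 - η * n ^ 2 ≤ #(G \ G.triangleEdges).edgeFinset := by
    have h5 : (n : ℝ) ^ 2 / 4 - 1 ≤ #G.edgeFinset + #(G.cliqueFinset 3) := by
      have : n ^ 2 ≤ 4 * (#G.edgeFinset + #(G.cliqueFinset 3)) + 4 := by omega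
      have : (n : ℝ) ^ 2 ≤ 4 * (#G.edgeFinset + #(G.cliqueFinset 3)) + 4 := by exact_mod_cast this
      linarith
    have h6 : 3 * (#(G.cliqueFinset 3) : ℝ) ≤ 4 * k * #G.triangleEdges.edgeFinset := by
      exact_mod_cast htri
    have h7 : (#(G \ G.triangleEdges).edgeFinset : ℝ) + #G.triangleEdges.edgeFinset
        = #G.edgeFinset := by exact_mod_cast hedges
    have h8 : (1 + 2 * k) * (#G.triangleEdges.edgeFinset : ℝ) ≤ η / 2 * n ^ 2 := by
      rw [← hεη]
      calc _ ≤ (1 + 2 * k) * (ε * (n : ℝ) ^ 2) := by gcongr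
        _ = _ := by ring
    have h9 : 1 ≤ η / 2 * n ^ 2 := by nlinarith
    have h10 : 0 ≤ k * (#G.triangleEdges.edgeFinset : ℝ) := by positivity
    linarith
  have hsub : ∑ a ∈ A, #((G \ G.triangleEdges).neighborFinset a ∩ Aᶜ)
      ≤ ∑ a ∈ A, #(G.neighborFinset a ∩ Aᶜ) := by
    refine sum_le_sum fun a _ ↦ card_le_card (inter_subset_inter_right fun b hb ↦ ?_)
    rw [mem_neighborFinset] at *
    exact hb.1
  have hX : ∑ a ∈ A, #(G.neighborFinset a ∩ Aᶜ) ≤ #A * #Aᶜ := by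
    rw [← smul_eq_mul, ← sum_const]
    exact sum_le_sum fun a _ ↦ card_le_card inter_subset_right
  have hA1 : 2 * #(G \ G.triangleEdges).edgeFinset
      ≤ ∑ a ∈ A, #(G.neighborFinset a ∩ Aᶜ) + #A * #Aᶜ := by
    refine le_trans (le_of_eq ?_) (hA.trans (Nat.add_le_add_right hsub _))
    congr!
  refine ⟨A, ?_⟩
  generalize ∑ a ∈ A, #(G.neighborFinset a ∩ Aᶜ) = X at *
  have hX' : (X : ℝ) ≤ #A * #Aᶜ := by exact_mod_cast hX
  have hA' : 2 * (#(G \ G.triangleEdges).edgeFinset : ℝ) ≤ X + #A * #Aᶜ := by exact_mod_cast hA1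
  have hprod : (#A : ℝ) * #Aᶜ ≤ n ^ 2 / 4 := by
    rw [← hAc]
    nlinarith [sq_nonneg ((#A : ℝ) - #Aᶜ)]
  exact ⟨by linarith, by linarith⟩

/-- If every degree plus the number of triangles through the vertex is at least half the order,
and edges and triangles together reach the Turán number, then there are no triangles: the vertices
respecting the near-complete cut of `exists_card_mul_card_compl_le` form two linked sets, one of
which meets each neighbourhood several times since all degrees are linear in `n`. -/
lemma cliqueFree_three_of_le_degree_add_triangleDegree {k : ℕ} (hk : 2 ≤ k) :
    ∃ n₀ : ℕ, ∀ (V : Type*) [Fintype V] [DecidableEq V] (G : SimpleGraph V) [DecidableRel G.Adj],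
      n₀ ≤ Fintype.card V → (cycleGraph (2 * k + 1)).Free G →
        (∀ v, Fintype.card V / 2 ≤ G.degree v + G.triangleDegree v) →
          Fintype.card V ^ 2 / 4 ≤ #G.edgeFinset + #(G.cliqueFinset 3) → G.CliqueFree 3 := by
  -- all degrees are at least `c * n`
  obtain ⟨c, hc⟩ : ∃ c : ℝ, c = 1 / (4 * (1 + 2 * k)) := ⟨_, rfl⟩
  have hk' : (2 : ℝ) ≤ k := by exact_mod_cast hk
  have hc0 : 0 < c := by rw [hc]; positivity
  have hck : c * (4 * (1 + 2 * k)) = 1 := by rw [hc]; field_simp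
  have hc1 : c ≤ 1 / 20 := by nlinarith
  -- with this choice at most `c * n / 8` vertices on each side are exceptional
  obtain ⟨η, hη⟩ : ∃ η : ℝ, η = c / 1024 := ⟨_, rfl⟩
  obtain ⟨n₁, hn₁⟩ := exists_card_mul_card_compl_le hk (η := η) (by rw [hη]; positivity)
  obtain ⟨n₂, hn₂⟩ := exists_nat_gt (7 / c)
  refine ⟨max (max n₁ n₂) (64 * (2 * k + 1)), fun V _ _ G _ hn hG hdeg hedge ↦ ?_⟩
  obtain ⟨A, hprod, hD1⟩ := hn₁ V G (by omega) hG hedge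
  have hAc : (#A : ℝ) + #Aᶜ = Fintype.card V := by exact_mod_cast card_add_card_compl A
  clear hn₁ hedge
  generalize Fintype.card V = n at *
  have h2 : 7 / c < (n : ℝ) := hn₂.trans_le (by exact_mod_cast (by omega : n₂ ≤ n))
  have h4 : 64 * (2 * k + 1) ≤ n := by omega
  have h4' : 64 * (2 * (k : ℝ) + 1) ≤ n := by exact_mod_cast h4
  rw [div_lt_iff₀ hc0] at h2
  have hn1 : (0 : ℝ) < n := by linarith
  have hD2 : (#Aᶜ * #A : ℝ) ≤ (∑ a ∈ Aᶜ, #(G.neighborFinset a ∩ A) : ℕ) + 2 * η * n ^ 2 := by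
    rwa [← sum_card_neighborFinset_inter_comm, mul_comm]
  have hAn : (n : ℝ) / 4 - η * n ≤ #A ∧ (n : ℝ) / 4 - η * n ≤ #Aᶜ := by
    have hle : (n / 4 - η * n) * n ≤ (#A : ℝ) * #Aᶜ := by
      calc _ = (n : ℝ) ^ 2 / 4 - η * n ^ 2 := by ring
        _ ≤ _ := hprod
    constructor <;> refine le_of_mul_le_mul_right (hle.trans ?_) hn1
    · exact mul_le_mul_of_nonneg_left (by linarith [(#A).cast_nonneg (α := ℝ)]) (by positivity)
    · rw [mul_comm]
      exact mul_le_mul_of_nonneg_left (by linarith [(#Aᶜ).cast_nonneg (α := ℝ)]) (by positivity)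
  -- each side has about `n / 4` vertices or more, so `γ = n / 32` leaves many common neighbours
  obtain ⟨γ, hγ⟩ : ∃ γ, γ = n / 32 := ⟨_, rfl⟩
  have hγ1 : (n : ℝ) / 64 ≤ γ := by
    have : n ≤ 64 * γ := by omega
    have : (n : ℝ) ≤ 64 * γ := by exact_mod_cast this
    linarith
  have hγ2 : (γ : ℝ) ≤ n / 32 := by
    have : 32 * γ ≤ n := by omega
    have : 32 * (γ : ℝ) ≤ n := by exact_mod_cast this
    linarith
  -- `x` stands for the number of exceptional vertices of one side
  have hbad : ∀ x : ℝ, 0 ≤ x → γ * x ≤ 2 * η * n ^ 2 → x ≤ c * n / 8 := by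
    intro x hx h
    have h5 : n / 64 * x ≤ γ * x := mul_le_mul_of_nonneg_right hγ1 hx
    refine le_of_mul_le_mul_right ?_ hn1
    calc x * n = 64 * (n / 64 * x) := by ring
      _ ≤ 64 * (2 * η * n ^ 2) := by linarith
      _ = c * n / 8 * n := by rw [hη]; ring
  obtain ⟨S, hS⟩ : ∃ S, S = G.nearlyComplete Aᶜ A γ := ⟨_, rfl⟩
  obtain ⟨T, hT⟩ : ∃ T, T = G.nearlyComplete A Aᶜ γ := ⟨_, rfl⟩
  have hbadS : (#(A \ S) : ℝ) ≤ c * n / 8 :=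
    hbad _ (by positivity) (hS ▸ mul_card_sdiff_nearlyComplete_le (by rwa [mul_comm]))
  have hbadT : (#(Aᶜ \ T) : ℝ) ≤ c * n / 8 :=
    hbad _ (by positivity) (hT ▸ mul_card_sdiff_nearlyComplete_le (by rwa [mul_comm]))
  have hSA : (#(A \ S) : ℝ) + #S = #A := by
    exact_mod_cast card_sdiff_add_card_eq_card (hS ▸ filter_subset _ _ : S ⊆ A)
  have hTA : (#(Aᶜ \ T) : ℝ) + #T = #Aᶜ := by
    exact_mod_cast card_sdiff_add_card_eq_card (hT ▸ filter_subset _ _ : T ⊆ Aᶜ)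
  have hcn : c * n ≤ 1 / 20 * n := mul_le_mul_of_nonneg_right hc1 hn1.le
  have hηn : η * n = c * n / 1024 := by rw [hη]; ring
  have hlarge : ∀ m : ℕ, (n : ℝ) / 4 - η * n - c * n / 8 ≤ m → 2 * k + 1 ≤ m := by
    intro m hm
    have : 2 * (k : ℝ) + 1 ≤ m := by linarith
    exact_mod_cast this
  have hlarge' : ∀ m : ℕ, (n : ℝ) / 4 - η * n ≤ m → 2 * k + 1 + 2 * γ ≤ m := by
    intro m hm
    have : 2 * (k : ℝ) + 1 + 2 * γ ≤ m := by linarith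
    exact_mod_cast this
  have hSL : G.IsLinked (2 * k + 1) S := by
    have := hlarge #S (by linarith [hAn.1])
    rw [hS] at this ⊢
    exact isLinked_nearlyComplete (hlarge' _ hAn.2) this
  have hTL : G.IsLinked (2 * k + 1) T := by
    have := hlarge #T (by linarith [hAn.2])
    rw [hT] at this ⊢
    exact isLinked_nearlyComplete (hlarge' _ hAn.1) this
  refine cliqueFree_three_of_isLinked hSL hTL hk le_rfl hG fun v ↦ ?_
  by_contra! hcon
  have hcover : G.degree v ≤ 4 + (#(A \ S) + #(Aᶜ \ T)) := by
    rw [← card_neighborFinset_eq_degree]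
    have hsubset : G.neighborFinset v ⊆ ((G.neighborFinset v ∩ S) ∪ (G.neighborFinset v ∩ T))
        ∪ ((A \ S) ∪ (Aᶜ \ T)) := by
      intro w hw
      simp only [mem_union, mem_inter, mem_sdiff, mem_compl]
      tauto
    refine (card_le_card hsubset).trans ((card_union_le _ _).trans ?_)
    have h5 := card_union_le (G.neighborFinset v ∩ S) (G.neighborFinset v ∩ T)
    have h6 := card_union_le (A \ S) (Aᶜ \ T)
    omega
  have hcover' : (G.degree v : ℝ) ≤ 4 + (#(A \ S) + #(Aᶜ \ T)) := by exact_mod_cast hcover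
  have hdv : c * n ≤ G.degree v := by
    have h5 := triangleDegree_le (by omega : 1 ≤ k) hG v
    have h6 : G.triangleEdges.degree v ≤ G.degree v := degree_le_of_le triangleEdges_le
    have h7 : 2 * k * G.triangleEdges.degree v ≤ 2 * k * G.degree v := Nat.mul_le_mul_left _ h6
    have h8 := hdeg v
    have h9 : n ≤ 4 * (G.degree v + 2 * k * G.degree v) := by omega
    have h10 : (n : ℝ) ≤ 4 * (G.degree v + 2 * k * G.degree v) := by exact_mod_cast h9
    calc c * n ≤ c * (4 * (G.degree v + 2 * k * G.degree v)) := by gcongr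
      _ = c * (4 * (1 + 2 * k)) * G.degree v := by ring
      _ = G.degree v := by rw [hck, one_mul]
  linarith

end Structure

/-! ### The Turán number and induction on the order -/

section Induction

lemma CliqueFree.card_edgeFinset_le_sq_div_four {V : Type*} [Fintype V] {G : SimpleGraph V}
    [DecidableRel G.Adj] (hG : G.CliqueFree 3) : #G.edgeFinset ≤ Fintype.card V ^ 2 / 4 := by
  have h := hG.card_edgeFinset_le
  rcases Nat.mod_two_eq_zero_or_one (Fintype.card V) with hm | hm <;> simp [hm] at h <;> omega

lemma card_edgeFinset_turanGraph_two (n : ℕ) : #(turanGraph n 2).edgeFinset = n ^ 2 / 4 := by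
  rw [card_edgeFinset_turanGraph]
  rcases Nat.even_or_odd' n with ⟨m, rfl | rfl⟩
  · simp
  · have : (2 * m + 1) ^ 2 = 4 * (m ^ 2 + m) + 1 := by ring
    simp [Nat.add_mod]
    omega

lemma sq_div_four_succ (n : ℕ) : (n + 1) ^ 2 / 4 = n ^ 2 / 4 + (n + 1) / 2 := by
  rcases Nat.even_or_odd' n with ⟨m, rfl | rfl⟩
  · have h1 : (2 * m + 1) ^ 2 = 4 * (m ^ 2 + m) + 1 := by ring
    have h2 : (2 * m) ^ 2 = 4 * m ^ 2 := by ring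
    omega
  · have h1 : (2 * m + 1) ^ 2 = 4 * (m ^ 2 + m) + 1 := by ring
    have h2 : (2 * m + 1 + 1) ^ 2 = 4 * (m ^ 2 + 2 * m + 1) := by ring
    omega

lemma CliqueFree.card_edgeFinset_add_card_cliqueFinset_le {V : Type*} [Fintype V] [DecidableEq V]
    {G : SimpleGraph V} [DecidableRel G.Adj] (hG : G.CliqueFree 3) :
    #G.edgeFinset + #(G.cliqueFinset 3) ≤ Fintype.card V ^ 2 / 4 := by
  rw [hG.cliqueFinset, card_empty, add_zero]
  exact hG.card_edgeFinset_le_sq_div_four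

/-- The case distinction behind the induction: either edges and triangles together do not reach the
Turán number, or the graph is triangle-free, or a vertex of small degree can be deleted. -/
lemma exists_forall_cliqueFree_three_or {k : ℕ} (hk : 1 ≤ k) :
    ∃ n₀ : ℕ, ∀ (V : Type*) [Fintype V] [DecidableEq V] (G : SimpleGraph V) [DecidableRel G.Adj],
      n₀ ≤ Fintype.card V → (cycleGraph (2 * k + 1)).Free G →
        #G.edgeFinset + #(G.cliqueFinset 3) < Fintype.card V ^ 2 / 4 ∨ G.CliqueFree 3 ∨
          ∃ v, G.degree v + G.triangleDegree v < Fintype.card V / 2 := by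
  rcases hk.eq_or_lt with rfl | hk
  · refine ⟨0, fun V _ _ G _ _ hG ↦ .inr (.inl ?_)⟩
    rw [mul_one, cycleGraph_three_eq_top] at hG
    exact (cliqueFree_iff_top_free (β := Fin 3)).2 hG
  · obtain ⟨n₀, h⟩ := cliqueFree_three_of_le_degree_add_triangleDegree hk
    refine ⟨n₀, fun V _ _ G _ hn hG ↦ ?_⟩
    by_contra! hcon
    exact hcon.2.1 (h V G hn hG hcon.2.2 hcon.1)

/-- Deleting a vertex that lies in fewer than `⌊n / 2⌋` edges and triangles increases the excess
over the Turán number, because `⌊n ^ 2 / 4⌋ - ⌊(n - 1) ^ 2 / 4⌋ = ⌊n / 2⌋`. -/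
lemma card_edgeFinset_add_card_cliqueFinset_lt_of_induce {V : Type*} [Fintype V] [DecidableEq V]
    {G : SimpleGraph V} [DecidableRel G.Adj] {v : V} {n D : ℕ} (hn : Fintype.card V = n + 1)
    (hv : G.degree v + G.triangleDegree v < Fintype.card V / 2)
    (h : #(G.induce {v}ᶜ).edgeFinset + #((G.induce {v}ᶜ).cliqueFinset 3) ≤ n ^ 2 / 4 + D) :
    #G.edgeFinset + #(G.cliqueFinset 3) < Fintype.card V ^ 2 / 4 + D := by
  have h1 := card_edgeFinset_induce_add_degree (G := G) v
  have h2 := card_cliqueFinset_three_le_induce (G := G) v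
  rw [hn] at hv ⊢
  have h3 := sq_div_four_succ n
  omega

lemma card_compl_singleton_of_card {V : Type*} [Fintype V] [DecidableEq V] {n : ℕ} {v : V}
    (hn : Fintype.card V = n + 1) : Fintype.card ({v}ᶜ : Set V) = n := by
  rw [Fintype.card_compl_set, hn]
  simp

lemma Free.induce {V W : Type*} {H : SimpleGraph W} {G : SimpleGraph V} (h : H.Free G) (s : Set V) :
    H.Free (G.induce s) :=
  fun hc ↦ h (hc.trans ⟨(Embedding.induce s).toCopy⟩)

/-- The excess of edges and triangles over the Turán number strictly increases, if positive, when a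
vertex of small degree is deleted. As it is bounded for graphs on `n₀` vertices, it has to vanish
for large graphs. -/
lemma card_edgeFinset_add_card_cliqueFinset_le {k : ℕ} (hk : 1 ≤ k) :
    ∃ n₀ K : ℕ, ∀ n, n₀ ≤ n → ∀ (V : Type*) [Fintype V] [DecidableEq V] (G : SimpleGraph V)
      [DecidableRel G.Adj], Fintype.card V = n → (cycleGraph (2 * k + 1)).Free G →
        #G.edgeFinset + #(G.cliqueFinset 3) ≤ n ^ 2 / 4 + (K - (n - n₀)) := by
  obtain ⟨n₀, h⟩ := exists_forall_cliqueFree_three_or hk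
  refine ⟨n₀, n₀.choose 2 + n₀.choose 3, fun n hn ↦ ?_⟩
  induction n, hn using Nat.le_induction with
  | base =>
    intro V _ _ G _ hV _
    have h1 := G.card_edgeFinset_le_card_choose_two
    have h2 := G.card_cliqueFinset_le (n := 3)
    rw [hV] at h1 h2
    omega
  | succ n hn ih =>
    intro V _ _ G _ hV hG
    rcases h V G (by omega) hG with hlt | hfree | ⟨v, hv⟩
    · rw [hV] at hlt
      omega
    · have := hfree.card_edgeFinset_add_card_cliqueFinset_le
      rw [hV] at this
      omega
    · have := card_edgeFinset_add_card_cliqueFinset_lt_of_induce hV hv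
        (ih _ (G.induce {v}ᶜ) (card_compl_singleton_of_card hV) (hG.induce _))
      rw [hV] at this
      omega

/-- Deleting a vertex once more shows that equality is only possible without triangles. -/
lemma card_edgeFinset_add_card_cliqueFinset_lt_or_cliqueFree {k : ℕ} (hk : 1 ≤ k) :
    ∃ n₀ : ℕ, ∀ (V : Type*) [Fintype V] [DecidableEq V] (G : SimpleGraph V) [DecidableRel G.Adj],
      n₀ ≤ Fintype.card V → (cycleGraph (2 * k + 1)).Free G →
        #G.edgeFinset + #(G.cliqueFinset 3) < Fintype.card V ^ 2 / 4 ∨ G.CliqueFree 3 := by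
  obtain ⟨n₁, h₁⟩ := exists_forall_cliqueFree_three_or hk
  obtain ⟨n₂, K, h₂⟩ := card_edgeFinset_add_card_cliqueFinset_le hk
  refine ⟨max n₁ (n₂ + K) + 1, fun V _ _ G _ hn hG ↦ ?_⟩
  rcases h₁ V G (by omega) hG with hlt | hfree | ⟨v, hv⟩
  · exact .inl hlt
  · exact .inr hfree
  · obtain ⟨n, hV⟩ : ∃ n, Fintype.card V = n + 1 := ⟨Fintype.card V - 1, by omega⟩
    have h3 := h₂ n (by omega) _ (G.induce {v}ᶜ) (card_compl_singleton_of_card hV) (hG.induce _)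
    rw [Nat.sub_eq_zero_of_le (by omega : K ≤ n - n₂)] at h3
    exact .inl (card_edgeFinset_add_card_cliqueFinset_lt_of_induce hV hv h3)

end Induction

end SimpleGraph


theorem mainTheorem2 (k : ℕ) (hk : 1 ≤ k) :
    ∃ n₀ : ℕ, ∀ n : ℕ, n₀ ≤ n →
      ∀ (V : Type*) [Fintype V] [DecidableEq V] (G : SimpleGraph V) [DecidableRel G.Adj],
        Fintype.card V = n →
        (SimpleGraph.cycleGraph (2 * k + 1)).Free G →
          G.edgeFinset.card + (G.cliqueFinset 3).card ≤ n ^ 2 / 4 ∧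
          (G.edgeFinset.card + (G.cliqueFinset 3).card = n ^ 2 / 4 ↔
            Nonempty (G ≃g SimpleGraph.turanGraph n 2)) := by
  obtain ⟨n₀, h⟩ := SimpleGraph.card_edgeFinset_add_card_cliqueFinset_lt_or_cliqueFree hk
  refine ⟨n₀, fun n hn V _ _ G _ hV hG ↦ ?_⟩
  subst hV
  have hcases := h V G hn hG
  refine ⟨hcases.elim le_of_lt fun hfree ↦ hfree.card_edgeFinset_add_card_cliqueFinset_le,
    fun heq ↦ ?_, fun ⟨f⟩ ↦ ?_⟩
  · have hfree := hcases.resolve_left heq.not_lt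
    rw [hfree.cliqueFinset, Finset.card_empty, add_zero] at heq
    refine (SimpleGraph.isTuranMaximal_iff_nonempty_iso_turanGraph two_pos).1
      ⟨hfree, fun H _ hH ↦ ?_⟩
    rw [heq]
    exact SimpleGraph.CliqueFree.card_edgeFinset_le_sq_div_four hH
  · have hfree : G.CliqueFree 3 := (SimpleGraph.turanGraph_cliqueFree two_pos).comap f.isContained
    rw [hfree.cliqueFinset, Finset.card_empty, add_zero, f.card_edgeFinset_eq,
      SimpleGraph.card_edgeFinset_turanGraph_two]
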